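/- **Conventions.** Let $W\in\mathbb{C}[x_1,\dots,x_k]$. A vector $(q_1,\dots,q_k)$ of positive rational numbers is a weight system of $W$ if every monomial $x_1^{a_1}\cdots x_k^{a_k}$ occurring in $W$ satisfies $\sum_i a_iq_i=1$. The polynomial $W$ is *admissible* if the origin is an isolated critical point of $W$ and $W$ has exactly one weight system. An admissible $W$ is *noninvertible* if it has more monomials than variables. Let $\mathcal{Q}_W=\mathbb{C}[x_1,\dots,x_k]/(\partial W/\partial x_1,\dots,\partial W/\partial x_k)$ be the Milnor ring of $W$. For an admissible $W$ with weights $(q_1,\dots,q_k)$, the *unorbifolded B-model* $\mathcal{B}_{W,\{0\}}$ is $\mathcal{Q}_W$, graded by $\deg(x_1^{a_1}\cdots x_k^{a_k})=2\sum_i a_iq_i$. Let $G_W^{max}=\{\zeta\in(\mathbb{C}^\times)^k : W(\zeta_1x_1,\dots,\zeta_kx_k)=W(x_1,\dots,x_k)\}$, and write an element of it as $g=(e^{2\pi i g_1},\dots,e^{2\pi i g_k})$ with phases $g_j\in[0,1)$. Let $J=(q_1,\dots,q_k)$ also denote the element of $G_W^{max}$ with coordinates $e^{2\pi i q_j}$.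 For a subgroup $G\le G_W^{max}$ containing $J$, the *A-model state space* is $$\mathcal{A}_{W,G}=\bigoplus_{g\in G}\bigl(\mathcal{Q}_{W|_{\mathrm{fix}(g)}}\bigr)^G .$$ Here $\mathrm{fix}(g)$ is the set of variables $x_j$ with $g_j=0$, and $W|_{\mathrm{fix}(g)}$ is the polynomial in these variables obtained from $W$ by setting the other variables to $0$. An element $h\in G$ acts on $\mathcal{Q}_{W|_{\mathrm{fix}(g)}}$ by $m\mapsto\det(h|_{\mathrm{fix}(g)})\, m\circ h$. The whole summand of $g$ is placed in degree $\#\mathrm{fix}(g)+2\sum_{j=1}^k(g_j-q_j)$. **Theorem.** Let $n>3$ be an integer, let $W$ be an admissible noninvertible polynomial in two variables with weight system $J=\left(\frac1n,\frac1n\right)$, and let $G=\langle J\rangle$. Then there is no admissible polynomial $W^T$ in two variables such that $\mathcal{A}_{W,G}$ and $\mathcal{B}_{W^T,\{0\}}$ are isomorphic as graded vector spaces over $\mathbb{C}$, that is, no linear isomorphism carries the degree $d$ part of $\mathcal{A}_{W,G}$ onto the degree $d$ part of $\mathcal{B}_{W^T,\{0\}}$ for every $d$. -/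

import Mathlib

open scoped Topology

noncomputable section

namespace LandauGinzburg

variable {σ : Type} [Fintype σ]

/-! ### Admissible polynomials -/

/-- The origin is an isolated critical point of `W`: all partial derivatives vanish there, and
they have no other common zero near it. -/
def IsNondegenerate (W : MvPolynomial σ ℂ) : Prop :=
  (∀ i, MvPolynomial.eval 0 (MvPolynomial.pderiv i W) = 0) ∧
    ∀ᶠ x in 𝓝[≠] (0 : σ → ℂ), ∃ i, MvPolynomial.eval x (MvPolynomial.pderiv i W) ≠ 0

/-- `q` is a system of quasihomogeneous weights of `W`: the `q i` are positive rationals and every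
monomial of `W` has weighted degree `1`. -/
structure IsWeightSystem (W : MvPolynomial σ ℂ) (q : σ → ℚ) : Prop where
  pos : ∀ i, 0 < q i
  homogeneous : MvPolynomial.IsWeightedHomogeneous q W 1

/-- Nondegenerate and quasihomogeneous, with unique weights. -/
def IsAdmissible (W : MvPolynomial σ ℂ) : Prop :=
  IsNondegenerate W ∧ ∃! q : σ → ℚ, IsWeightSystem W q

/-- More monomials than variables. -/
def IsNoninvertible (W : MvPolynomial σ ℂ) : Prop :=
  Fintype.card σ < W.support.card

/-! ### Diagonal symmetries -/

/-- The substitution `p(x) ↦ p(ζ x)`. -/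
def scale {τ : Type} (ζ : τ → ℂˣ) : MvPolynomial τ ℂ →ₐ[ℂ] MvPolynomial τ ℂ :=
  MvPolynomial.aeval fun i => MvPolynomial.C (ζ i : ℂ) * MvPolynomial.X i

theorem scale_one {τ : Type} : scale (1 : τ → ℂˣ) = AlgHom.id ℂ (MvPolynomial τ ℂ) := by
  ext i
  simp [scale]

theorem scale_mul {τ : Type} (ζ η : τ → ℂˣ) : scale (ζ * η) = (scale ζ).comp (scale η) := by
  refine MvPolynomial.algHom_ext fun i => ?_
  simp [scale, MvPolynomial.algHom_C, mul_left_comm, mul_assoc]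

/-- The maximal diagonal symmetry group: all `ζ` with `W(ζ x) = W(x)`. -/
def maxSymmetryGroup {τ : Type} (W : MvPolynomial τ ℂ) : Subgroup (τ → ℂˣ) where
  carrier := {ζ | scale ζ W = W}
  one_mem' := by simp [scale_one]
  mul_mem' := by
    intro a b ha hb
    simp only [Set.mem_ofPred_eq] at ha hb ⊢
    rw [scale_mul, AlgHom.comp_apply, hb, ha]
  inv_mem' := by
    intro a ha
    simp only [Set.mem_ofPred_eq] at ha ⊢
    have h : scale (a⁻¹ * a) W = W := by simp [scale_one]
    rw [scale_mul, AlgHom.comp_apply, ha] at h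
    exact h

/-- The element `J = (exp(2πi q₁), …, exp(2πi q_k))` attached to a weight vector `q`. -/
def gradingElement (q : σ → ℚ) : σ → ℂˣ := fun i =>
  Units.mk0 (Complex.exp (2 * Real.pi * Complex.I * (q i : ℂ))) (Complex.exp_ne_zero _)

theorem scale_monomial (ζ : σ → ℂˣ) (m : σ →₀ ℕ) (c : ℂ) :
    scale ζ (MvPolynomial.monomial m c) =
      MvPolynomial.monomial m ((∏ i, (ζ i : ℂ) ^ m i) * c) := by
  rw [scale, MvPolynomial.aeval_monomial, Finsupp.prod_fintype _ _ (by simp)]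
  simp only [mul_pow, Finset.prod_mul_distrib]
  rw [MvPolynomial.monomial_eq, Finsupp.prod_fintype _ _ (by simp)]
  simp only [map_mul, map_prod, map_pow, MvPolynomial.algebraMap_eq]
  ring

theorem gradingElement_mem {W : MvPolynomial σ ℂ} {q : σ → ℚ} (h : IsWeightSystem W q) :
    gradingElement q ∈ maxSymmetryGroup W := by
  change scale (gradingElement q) W = W
  conv_lhs => rw [W.as_sum]
  conv_rhs => rw [W.as_sum]
  rw [map_sum]
  refine Finset.sum_congr rfl fun m hm => ?_
  have hd : ∑ i, (m i : ℚ) * q i = 1 := by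
    have h1 := h.homogeneous (MvPolynomial.mem_support_iff.mp hm)
    rw [Finsupp.weight_apply, Finsupp.sum_fintype _ _ (by simp)] at h1
    simpa using h1
  have hd' : ∑ i, (m i : ℂ) * (q i : ℂ) = 1 := by exact_mod_cast congrArg (Rat.cast : ℚ → ℂ) hd
  have hprod : ∏ i, ((gradingElement q i : ℂˣ) : ℂ) ^ m i = 1 := by
    simp only [gradingElement, Units.val_mk0, ← Complex.exp_nat_mul]
    rw [← Complex.exp_sum]
    have : ∑ i, (m i : ℂ) * (2 * Real.pi * Complex.I * (q i : ℂ)) = 2 * Real.pi * Complex.I := by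
      calc _ = ∑ i, 2 * Real.pi * Complex.I * ((m i : ℂ) * (q i : ℂ)) :=
            Finset.sum_congr rfl fun i _ => by ring
        _ = _ := by rw [← Finset.mul_sum, hd', mul_one]
    rw [this, Complex.exp_two_pi_mul_I]
  rw [scale_monomial, hprod, one_mul]

theorem zpowers_gradingElement_le {W : MvPolynomial σ ℂ} {q : σ → ℚ} (h : IsWeightSystem W q) :
    Subgroup.zpowers (gradingElement q) ≤ maxSymmetryGroup W :=
  Subgroup.zpowers_le.mpr (gradingElement_mem h)

/-- The phase of a complex number of modulus one: the `θ ∈ [0, 1)` with `z = exp(2πi θ)`. -/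
def phase (z : ℂˣ) : ℝ := Int.fract (Complex.arg (z : ℂ) / (2 * Real.pi))

theorem exp_phase (z : ℂˣ) (hz : ‖(z : ℂ)‖ = 1) :
    Complex.exp (2 * Real.pi * Complex.I * (phase z : ℂ)) = z := by
  have h := Complex.norm_mul_exp_arg_mul_I (z : ℂ)
  rw [hz, Complex.ofReal_one, one_mul] at h
  conv_rhs => rw [← h]
  rw [Complex.exp_eq_exp_iff_exists_int]
  refine ⟨-⌊Complex.arg (z : ℂ) / (2 * Real.pi)⌋, ?_⟩
  have hpi : (Real.pi : ℂ) ≠ 0 := by exact_mod_cast Real.pi_ne_zero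
  rw [phase, Int.fract]
  push_cast
  field_simp
  ring

/-! ### The Milnor ring and the action of symmetries on it -/

/-- The Jacobian ideal `(∂W/∂x_i)_i`. -/
def jacobianIdeal {τ : Type} (W : MvPolynomial τ ℂ) : Ideal (MvPolynomial τ ℂ) :=
  Ideal.span (Set.range fun i => MvPolynomial.pderiv i W)

/-- The Milnor ring `Q_W`, which is also the unorbifolded B-model of `W`. -/
abbrev MilnorRing {τ : Type} (W : MvPolynomial τ ℂ) : Type :=
  MvPolynomial τ ℂ ⧸ jacobianIdeal W

theorem pderiv_scale {τ : Type} (ζ : τ → ℂˣ) (i : τ) (p : MvPolynomial τ ℂ) :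
    MvPolynomial.pderiv i (scale ζ p) =
      MvPolynomial.C (ζ i : ℂ) * scale ζ (MvPolynomial.pderiv i p) := by
  classical
  induction p using MvPolynomial.induction_on with
  | C a => simp [scale, MvPolynomial.algHom_C]
  | add p q hp hq => simp [hp, hq, mul_add]
  | mul_X p j hp =>
    have hX : scale ζ (MvPolynomial.X j) = MvPolynomial.C (ζ j : ℂ) * MvPolynomial.X j := by
      simp [scale]
    rw [map_mul, MvPolynomial.pderiv_mul, hp, hX, MvPolynomial.pderiv_C_mul,
      MvPolynomial.pderiv_mul, map_add, map_mul, map_mul, hX, MvPolynomial.pderiv_X]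
    by_cases hij : i = j
    · subst hij
      simp
      ring
    · rw [Pi.single_eq_of_ne (Ne.symm hij)]
      simp
      ring

theorem jacobianIdeal_le_comap {τ : Type} {W : MvPolynomial τ ℂ} {ζ : τ → ℂˣ}
    (hζ : ζ ∈ maxSymmetryGroup W) :
    jacobianIdeal W ≤ (jacobianIdeal W).comap (scale ζ) := by
  refine Ideal.span_le.mpr ?_
  rintro _ ⟨i, rfl⟩
  have h : scale ζ W = W := hζ
  have h1 := pderiv_scale ζ i W
  rw [h] at h1
  have h2 : scale ζ (MvPolynomial.pderiv i W) =
      MvPolynomial.C ((ζ i : ℂ)⁻¹) * MvPolynomial.pderiv i W := by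
    conv_rhs => rw [h1]
    rw [← mul_assoc, ← map_mul, inv_mul_cancel₀ (ζ i).ne_zero, map_one, one_mul]
  change scale ζ (MvPolynomial.pderiv i W) ∈ jacobianIdeal W
  rw [h2]
  exact Ideal.mul_mem_left _ _ (Ideal.subset_span ⟨i, rfl⟩)

/-- The action `ζ^*(m) = det(ζ) · (m ∘ ζ)` of a symmetry of `W` on the Milnor ring of `W`. -/
def milnorAction (W : MvPolynomial σ ℂ) (ζ : maxSymmetryGroup W) :
    MilnorRing W →ₗ[ℂ] MilnorRing W :=
  (∏ i, (ζ.1 i : ℂ)) •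
    (Ideal.quotientMapₐ (jacobianIdeal W) (scale ζ.1) (jacobianIdeal_le_comap ζ.2)).toLinearMap

/-- The `G`-invariant subspace of the Milnor ring of `W`. -/
def invariants (W : MvPolynomial σ ℂ) (G : Subgroup (σ → ℂˣ)) (hG : G ≤ maxSymmetryGroup W) :
    Submodule ℂ (MilnorRing W) where
  carrier := {m | ∀ (ζ : σ → ℂˣ) (hζ : ζ ∈ G), milnorAction W ⟨ζ, hG hζ⟩ m = m}
  zero_mem' := by intro ζ hζ; exact map_zero _
  add_mem' := by intro a b ha hb ζ hζ; rw [map_add, ha ζ hζ, hb ζ hζ]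
  smul_mem' := by intro c a ha ζ hζ; rw [map_smul, ha ζ hζ]

/-! ### The A-model state space -/

/-- The (indices of the) variables fixed by `g`. -/
abbrev Fix {τ : Type} (g : τ → ℂˣ) : Type := {i : τ // g i = 1}

/-- The restriction `p|_{fix(g)}`: the variables that `g` moves are set to `0`. -/
def restrict {τ : Type} (g : τ → ℂˣ) : MvPolynomial τ ℂ →ₐ[ℂ] MvPolynomial (Fix g) ℂ :=
  MvPolynomial.aeval fun i => if h : g i = 1 then MvPolynomial.X ⟨i, h⟩ else 0

/-- Diagonal symmetries act on the fixed locus of `g` by restriction. -/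
def restrictHom {τ : Type} (g : τ → ℂˣ) : (τ → ℂˣ) →* (Fix g → ℂˣ) where
  toFun ζ i := ζ i.1
  map_one' := rfl
  map_mul' _ _ := rfl

theorem restrict_scale {τ : Type} (g ζ : τ → ℂˣ) (p : MvPolynomial τ ℂ) :
    restrict g (scale ζ p) = scale (restrictHom g ζ) (restrict g p) := by
  suffices h : (restrict g).comp (scale ζ) = (scale (restrictHom g ζ)).comp (restrict g) from
    DFunLike.congr_fun h p
  refine MvPolynomial.algHom_ext fun i => ?_
  by_cases h : g i = 1
  · simp [restrict, scale, restrictHom, h, MvPolynomial.algHom_C]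
  · simp [restrict, scale, h]

theorem map_restrictHom_le {τ : Type} {W : MvPolynomial τ ℂ} {G : Subgroup (τ → ℂˣ)}
    (hG : G ≤ maxSymmetryGroup W) (g : τ → ℂˣ) :
    G.map (restrictHom g) ≤ maxSymmetryGroup (restrict g W) := by
  rintro _ ⟨ζ, hζ, rfl⟩
  change scale (restrictHom g ζ) (restrict g W) = restrict g W
  rw [← restrict_scale, show scale ζ W = W from hG hζ]

/-- The sector of `g`: the `G`-invariants of the Milnor ring of `W|_{fix(g)}`. -/
abbrev Sector (W : MvPolynomial σ ℂ) (G : Subgroup (σ → ℂˣ)) (hG : G ≤ maxSymmetryGroup W)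
    (g : G) : Type :=
  invariants (restrict g.1 W) (G.map (restrictHom g.1)) (map_restrictHom_le hG g.1)

/-- The A-model state space `A_{W,G}`: the direct sum of the sectors of all `g ∈ G`. -/
abbrev AModel (W : MvPolynomial σ ℂ) (G : Subgroup (σ → ℂˣ)) (hG : G ≤ maxSymmetryGroup W) :
    Type :=
  DirectSum G (Sector W G hG)

/-- The degree `dim fix(g) + 2 ∑ (g_i - q_i)` of the sector of `g`, with `g_i` the phases of
`g`. -/
def sectorDegree (q : σ → ℚ) (g : σ → ℂˣ) : ℝ :=
  (Fintype.card (Fix g) : ℝ) + 2 * ∑ i, (phase (g i) - (q i : ℝ))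

/-- The degree `d` part of the A-model of a polynomial with weights `q`: the sum of the sectors of
degree `d`. -/
def aPiece (W : MvPolynomial σ ℂ) (q : σ → ℚ) (G : Subgroup (σ → ℂˣ))
    (hG : G ≤ maxSymmetryGroup W) (d : ℝ) : Submodule ℂ (AModel W G hG) where
  carrier := {v | ∀ g : G, sectorDegree q g.1 ≠ d → v g = 0}
  zero_mem' := by intro g _; rfl
  add_mem' := by intro a b ha hb g hg; rw [DirectSum.add_apply, ha g hg, hb g hg, add_zero]
  smul_mem' := by intro c a ha g hg; rw [DirectSum.smul_apply, ha g hg, smul_zero]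

/-- The degree `d` part of the unorbifolded B-model of a polynomial with weights `q`: it is spanned
by the classes of the monomials `∏ x_i ^ a_i` with `2 ∑ a_i q_i = d`. -/
def bPiece (W : MvPolynomial σ ℂ) (q : σ → ℚ) (d : ℝ) : Submodule ℂ (MilnorRing W) :=
  (MvPolynomial.weightedHomogeneousSubmodule ℂ (fun i => 2 * (q i : ℝ)) d).map
    (Ideal.Quotient.mkₐ ℂ (jacobianIdeal W)).toLinearMap

/-- An isomorphism of graded vector spaces: a linear isomorphism that carries each graded piece
onto the graded piece of the same degree. -/
def GradedIso {U V : Type} [AddCommMonoid U] [Module ℂ U] [AddCommMonoid V] [Module ℂ V]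
    (𝒰 : ℝ → Submodule ℂ U) (𝒱 : ℝ → Submodule ℂ V) : Prop :=
  ∃ φ : U ≃ₗ[ℂ] V, ∀ d, (𝒰 d).map φ.toLinearMap = 𝒱 d

end LandauGinzburg

end

/-! Only the sets of degrees are compared. Since `J` has equal weights, the sector of `J^j` with `0
< j < n` is one-dimensional of degree `4(j - 1)/n`, and the identity sector has degree `(2n - 4)/n`.
So the top degree of the A-model is `4 - 8/n`, and nothing lies strictly between `0` and `4/n`.

For a B-model with weights `q`, the partial derivatives are coprime and form a complete
intersection. Its Hilbert series then gives the top degree `4 - 4(q 0 + q 1)` (`top_degree`). A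
graded isomorphism would force `q 0 + q 1 = 2/n`, hence some `q i ≤ 1/n`. The class of `X i` then
has degree in `(0, 4/n)`, so it vanishes. By `weight_add_of_X_mem` this requires `q i + q j = 1` for
some `j`, whereas `q i + q j ≤ 3/n < 1`. -/

namespace LandauGinzburg

open PowerSeries Module

/-! ### Hilbert series of graded complete intersections -/

section HilbertSeries

variable {K A : Type*} [Field K] [CommRing A] [Algebra K A] (𝒜 : ℕ → Submodule K A)

/-- The generating function of the dimensions of the graded pieces of an ideal `I`. -/
noncomputable def dimSeries (I : Ideal A) : PowerSeries ℤ :=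
  PowerSeries.mk fun d => (finrank K ↥(𝒜 d ⊓ I.restrictScalars K) : ℤ)

/-- The difference is the Hilbert series of `A ⧸ I`; working with ideals avoids putting a grading on
the quotient. -/
theorem coeff_dimSeries_top_sub_eq_zero_iff [∀ d, Module.Finite K (𝒜 d)] (I : Ideal A) (d : ℕ) :
    coeff d (dimSeries 𝒜 ⊤ - dimSeries 𝒜 I) = 0 ↔ 𝒜 d ≤ I.restrictScalars K := by
  have h : 𝒜 d ⊓ (⊤ : Ideal A).restrictScalars K = 𝒜 d := by ext; simp
  simp only [map_sub, dimSeries, coeff_mk, sub_eq_zero, Nat.cast_inj]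
  rw [h]
  constructor
  · intro h
    exact inf_eq_left.mp (Submodule.eq_of_le_of_finrank_eq inf_le_left h.symm)
  · intro h
    rw [inf_eq_left.mpr h]

variable [GradedAlgebra 𝒜]

/-- Homogeneity makes taking the degree `d` piece commute with `⊔`; the rest is the dimension
formula for two subspaces. -/
theorem dimSeries_sup_add_inf [∀ d, Module.Finite K (𝒜 d)] {I J : Ideal A}
    (hI : I.IsHomogeneous 𝒜) (hJ : J.IsHomogeneous 𝒜) :
    dimSeries 𝒜 (I ⊔ J) + dimSeries 𝒜 (I ⊓ J) = dimSeries 𝒜 I + dimSeries 𝒜 J := by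
  ext d
  simp only [map_add, dimSeries, coeff_mk]
  have hsup : 𝒜 d ⊓ (I ⊔ J).restrictScalars K =
      (𝒜 d ⊓ I.restrictScalars K) ⊔ (𝒜 d ⊓ J.restrictScalars K) := by
    apply le_antisymm
    · rintro x ⟨hx, hx'⟩
      obtain ⟨y, hy, z, hz, rfl⟩ := Submodule.mem_sup.mp hx'
      have h : (DirectSum.decompose 𝒜 (y + z) d : A) =
          DirectSum.decompose 𝒜 y d + DirectSum.decompose 𝒜 z d := by
        simp [DirectSum.decompose_add]
      rw [DirectSum.decompose_of_mem_same 𝒜 hx] at h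
      rw [h]
      exact Submodule.add_mem_sup ⟨SetLike.coe_mem _, hI d hy⟩ ⟨SetLike.coe_mem _, hJ d hz⟩
    · exact sup_le (inf_le_inf_left _ fun x hx => Submodule.mem_sup_left hx)
        (inf_le_inf_left _ fun x hx => Submodule.mem_sup_right hx)
  have hinf : 𝒜 d ⊓ (I ⊓ J).restrictScalars K =
      (𝒜 d ⊓ I.restrictScalars K) ⊓ (𝒜 d ⊓ J.restrictScalars K) := by
    ext x
    simp only [Submodule.mem_inf, Submodule.restrictScalars_mem]
    tauto
  rw [hsup, hinf]
  have hf (L : Ideal A) : Module.Finite K ↥(𝒜 d ⊓ L.restrictScalars K) :=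
    Submodule.finiteDimensional_of_le (S₂ := 𝒜 d) inf_le_left
  have := hf I
  have := hf J
  exact_mod_cast Submodule.finrank_sup_add_finrank_inf_eq _ _

variable [IsDomain A]

/-- In a domain, multiplication by `f` is injective and shifts degrees by `a`. -/
theorem dimSeries_span_singleton {f : A} {a : ℕ} (hf : f ∈ 𝒜 a) (hf0 : f ≠ 0) :
    dimSeries 𝒜 (Ideal.span {f}) = X ^ a * dimSeries 𝒜 ⊤ := by
  ext d
  rw [coeff_X_pow_mul']
  simp only [dimSeries, coeff_mk]
  split_ifs with h
  · have h1 : 𝒜 (d - a) ⊓ (⊤ : Ideal A).restrictScalars K = 𝒜 (d - a) := by ext; simp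
    have h2 : 𝒜 d ⊓ (Ideal.span {f}).restrictScalars K =
        (𝒜 (d - a)).map (LinearMap.mulLeft K f) := by
      ext x
      simp only [Submodule.mem_inf, Submodule.restrictScalars_mem, Ideal.mem_span_singleton,
        Submodule.mem_map, LinearMap.mulLeft_apply]
      constructor
      · rintro ⟨hx, y, rfl⟩
        refine ⟨DirectSum.decompose 𝒜 y (d - a), SetLike.coe_mem _, ?_⟩
        rw [← DirectSum.coe_decompose_mul_of_left_mem_of_le 𝒜 hf h,
          DirectSum.decompose_of_mem_same 𝒜 hx]
      · rintro ⟨y, hy, rfl⟩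
        refine ⟨?_, y, rfl⟩
        have := SetLike.mul_mem_graded hf hy
        rwa [Nat.add_sub_cancel' h] at this
    rw [h1, h2,
      ← (Submodule.equivMapOfInjective (LinearMap.mulLeft K f)
        (fun x y hxy => mul_left_cancel₀ hf0 hxy) _).finrank_eq]
  · have h2 : 𝒜 d ⊓ (Ideal.span {f}).restrictScalars K = ⊥ := by
      rw [eq_bot_iff]
      rintro x ⟨hx, hx'⟩
      obtain ⟨y, rfl⟩ := Ideal.mem_span_singleton.mp hx'
      have := DirectSum.coe_decompose_mul_of_left_mem_of_not_le 𝒜 (b := y) hf h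
      rw [DirectSum.decompose_of_mem_same 𝒜 hx] at this
      exact this
    rw [h2]
    simp

/-- Inclusion-exclusion for the two principal ideals: coprimality identifies their intersection with
the ideal of `f * g`, so all terms are shifts of one series. -/
theorem dimSeries_top_sub_span_pair [∀ d, Module.Finite K (𝒜 d)] [DecompositionMonoid A]
    {f g : A} {a b : ℕ} (hf : f ∈ 𝒜 a) (hg : g ∈ 𝒜 b) (hf0 : f ≠ 0) (hg0 : g ≠ 0)
    (hfg : IsRelPrime f g) :
    dimSeries 𝒜 ⊤ - dimSeries 𝒜 (Ideal.span {f, g}) =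
      (1 - X ^ a) * (1 - X ^ b) * dimSeries 𝒜 ⊤ := by
  have hom {f : A} {a : ℕ} (hf : f ∈ 𝒜 a) : (Ideal.span {f}).IsHomogeneous 𝒜 :=
    Ideal.homogeneous_span 𝒜 _ (by rintro x rfl; exact ⟨a, hf⟩)
  have h := dimSeries_sup_add_inf 𝒜 (hom hf) (hom hg)
  have hinf : Ideal.span {f} ⊓ Ideal.span {g} = Ideal.span {f * g} := by
    ext x
    simp only [Submodule.mem_inf, Ideal.mem_span_singleton]
    exact ⟨fun h => hfg.mul_dvd h.1 h.2,
      fun h => ⟨(dvd_mul_right f g).trans h, (dvd_mul_left g f).trans h⟩⟩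
  rw [hinf, dimSeries_span_singleton 𝒜 hf hf0, dimSeries_span_singleton 𝒜 hg hg0,
    dimSeries_span_singleton 𝒜 (SetLike.mul_mem_graded hf hg) (mul_ne_zero hf0 hg0),
    ← Ideal.span_union, Set.singleton_union] at h
  rw [eq_sub_of_add_eq h]
  ring

end HilbertSeries

theorem natDegree_one_sub_X_pow (a : ℕ) :
    (1 - Polynomial.X ^ a : Polynomial ℤ).natDegree = a := by
  rw [← Polynomial.C_1, Polynomial.natDegree_sub, Polynomial.natDegree_X_pow_sub_C]

/-- The degree of a polynomial Hilbert series of complete intersection type. -/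
theorem degree_of_mul_eq {H : PowerSeries ℤ} {T a b u v : ℕ} (ha : a ≠ 0) (hb : b ≠ 0)
    (hu : u ≠ 0) (hv : v ≠ 0) (hT : coeff T H ≠ 0) (hH : ∀ d, T < d → coeff d H = 0)
    (h : H * ((1 - X ^ u) * (1 - X ^ v)) = (1 - X ^ a) * (1 - X ^ b)) :
    T + (u + v) = a + b := by
  have ne (a : ℕ) (ha : a ≠ 0) : (1 - Polynomial.X ^ a : Polynomial ℤ) ≠ 0 := by
    intro h0
    have := natDegree_one_sub_X_pow a
    rw [h0] at this
    exact ha this.symm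
  -- Since `H` vanishes beyond `T`, it is a polynomial, and degrees can be compared in the product
  -- formula.
  have hP : ((trunc (T + 1) H : Polynomial ℤ) : PowerSeries ℤ) = H := by
    ext d
    rw [Polynomial.coeff_coe, coeff_trunc]
    split_ifs with h
    · rfl
    · exact (hH d (by omega)).symm
  have hdeg : (trunc (T + 1) H).natDegree = T := by
    refine le_antisymm (Nat.lt_succ_iff.mp (natDegree_trunc_lt H T))
      (Polynomial.le_natDegree_of_ne_zero ?_)
    rw [coeff_trunc, if_pos T.lt_succ_self]
    exact hT
  have hne : trunc (T + 1) H ≠ 0 := by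
    intro h0
    rw [h0, Polynomial.coe_zero] at hP
    rw [← hP] at hT
    simp at hT
  have hpoly : trunc (T + 1) H * ((1 - Polynomial.X ^ u) * (1 - Polynomial.X ^ v)) =
      (1 - Polynomial.X ^ a) * (1 - Polynomial.X ^ b) := by
    apply Polynomial.coe_injective
    push_cast
    rw [hP]
    exact h
  have := congrArg Polynomial.natDegree hpoly
  rwa [Polynomial.natDegree_mul hne (mul_ne_zero (ne u hu) (ne v hv)),
    Polynomial.natDegree_mul (ne u hu) (ne v hv), Polynomial.natDegree_mul (ne a ha) (ne b hb),
    hdeg, natDegree_one_sub_X_pow u, natDegree_one_sub_X_pow v,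
    natDegree_one_sub_X_pow a, natDegree_one_sub_X_pow b] at this

end LandauGinzburg

/-! ### Milnor rings of quasihomogeneous polynomials in two variables -/

namespace LandauGinzburg

open MvPolynomial
open scoped Topology

theorem eval_scale_weights {σ : Type} [Fintype σ] {w : σ → ℕ} {p : MvPolynomial σ ℂ} {m : ℕ}
    (hp : IsWeightedHomogeneous w p m) (t : ℂ) (x : σ → ℂ) :
    eval (fun i => t ^ w i * x i) p = t ^ m * eval x p := by
  rw [eval_eq', eval_eq', Finset.mul_sum]
  refine Finset.sum_congr rfl fun d hd => ?_
  have h := hp (mem_support_iff.mp hd)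
  rw [Finsupp.weight_apply, Finsupp.sum_fintype _ _ (by simp)] at h
  simp only [mul_pow, Finset.prod_mul_distrib, ← pow_mul]
  rw [Finset.prod_pow_eq_pow_sum, ← h]
  simp only [smul_eq_mul, mul_comm (w _)]
  ring

theorem isWeightedHomogeneous_pderiv {σ : Type} {w : σ → ℕ} {p : MvPolynomial σ ℂ} {m : ℕ}
    (hp : IsWeightedHomogeneous w p m) (i : σ) :
    IsWeightedHomogeneous w (pderiv i p) (m - w i) := by
  intro d hd
  have h : coeff (d + Finsupp.single i 1) p ≠ 0 := by
    intro h0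
    apply hd
    rw [coeff_pderiv, h0, zero_mul]
  have := hp h
  rw [map_add, Finsupp.weight_single] at this
  simp at this
  omega

theorem isRelPrime_X_zero_X_one :
    IsRelPrime (X 0 : MvPolynomial (Fin 2) ℂ) (X 1) := by
  have h0 : Irreducible (X 0 : MvPolynomial (Fin 2) ℂ) := X_prime.irreducible
  refine h0.isRelPrime_iff_not_dvd.mpr fun h => ?_
  simp at h

/-- If `h` had no zero off the origin, the Nullstellensatz would make it divide powers of both
coprime variables, hence be a unit. -/
theorem exists_ne_zero_eval_eq_zero {h : MvPolynomial (Fin 2) ℂ} (hh : ¬ IsUnit h) :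
    ∃ x : Fin 2 → ℂ, x ≠ 0 ∧ eval x h = 0 := by
  by_contra! hx
  have hdvd (i : Fin 2) : ∃ k : ℕ, h ∣ X i ^ k := by
    have hmem : (X i : MvPolynomial (Fin 2) ℂ) ∈
        vanishingIdeal ℂ (zeroLocus ℂ (Ideal.span {h})) := by
      rw [mem_vanishingIdeal_iff]
      intro x hxz
      have h0 : eval x h = 0 := by
        have := hxz h (Ideal.mem_span_singleton_self h)
        rwa [aeval_eq_eval] at this
      have : x = 0 := by
        by_contra hne
        exact hx x hne h0
      simp [this]
    rw [vanishingIdeal_zeroLocus_eq_radical] at hmem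
    obtain ⟨k, hk⟩ := hmem
    exact ⟨k, Ideal.mem_span_singleton.mp hk⟩
  obtain ⟨k, hk⟩ := hdvd 0
  obtain ⟨l, hl⟩ := hdvd 1
  exact hh (isRelPrime_X_zero_X_one.pow hk hl)

variable {V : MvPolynomial (Fin 2) ℂ} {w : Fin 2 → ℕ} {N : ℕ}

/-- A common nonunit factor has a zero `x ≠ 0`, which is a critical point. Its orbit under `t ↦ (t ^
w i * x i)` consists of critical points and tends to the origin, which is then not isolated. -/
theorem isRelPrime_pderiv (hV : IsNondegenerate V) (hw : ∀ i, w i ≠ 0)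
    (hN : IsWeightedHomogeneous w V N) : IsRelPrime (pderiv 0 V) (pderiv 1 V) := by
  intro h h0 h1
  by_contra hu
  obtain ⟨x, hx, hxh⟩ := exists_ne_zero_eval_eq_zero hu
  have hz (i : Fin 2) : eval x (pderiv i V) = 0 := by
    have hd : h ∣ pderiv i V := by
      fin_cases i
      exacts [h0, h1]
    obtain ⟨r, hr⟩ := hd
    rw [hr, map_mul, hxh, zero_mul]
  have hcont : Filter.Tendsto (fun t : ℂ => fun i => t ^ w i * x i) (𝓝[≠] 0)
      (𝓝[≠] (0 : Fin 2 → ℂ)) := by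
    refine tendsto_nhdsWithin_iff.mpr ⟨?_, ?_⟩
    · have hc : Continuous (fun t : ℂ => fun i => t ^ w i * x i) := by fun_prop
      have := hc.tendsto 0
      have h0 : (fun i => (0 : ℂ) ^ w i * x i) = 0 := by
        funext i
        simp [hw i]
      rw [h0] at this
      exact this.mono_left nhdsWithin_le_nhds
    · filter_upwards [self_mem_nhdsWithin] with t ht h0
      apply hx
      funext i
      have := congrFun h0 i
      simpa [show t ≠ 0 from ht] using this
  obtain ⟨t, i, hi⟩ := (hcont.eventually hV.2).exists
  apply hi
  rw [eval_scale_weights (isWeightedHomogeneous_pderiv hN i), hz, mul_zero]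

/-- If one partial were zero, coprimality would make the other a unit, yet it vanishes at the
origin. -/
theorem pderiv_ne_zero (hV : IsNondegenerate V)
    (hrel : IsRelPrime (pderiv 0 V) (pderiv 1 V)) (i : Fin 2) : pderiv i V ≠ 0 := by
  have key {f g : MvPolynomial (Fin 2) ℂ} (h : IsRelPrime f g) (hg : eval 0 g = 0) : f ≠ 0 := by
    rintro rfl
    have := (isRelPrime_zero_left.mp h).map (eval (0 : Fin 2 → ℂ))
    rw [hg] at this
    exact not_isUnit_zero this
  fin_cases i
  exacts [key hrel (hV.1 1), key hrel.symm (hV.1 0)]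

/-- The `i`-th partial is nonzero without constant term, so it has a monomial of positive weight;
this also keeps the subtraction `N - w i` from truncating. -/
theorem weight_lt (hV : IsNondegenerate V) (hw : ∀ i, w i ≠ 0)
    (hN : IsWeightedHomogeneous w V N) (i : Fin 2) : w i < N := by
  obtain ⟨d, hd⟩ := ne_zero_iff.mp (pderiv_ne_zero hV (isRelPrime_pderiv hV hw hN) i)
  have hd0 : d ≠ 0 := by
    rintro rfl
    have := hV.1 i
    rw [← constantCoeff_eq] at hd
    exact hd (by rwa [← eval_zero'])
  have h1 := isWeightedHomogeneous_pderiv hN i hd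
  have h2 : Finsupp.weight w d ≠ 0 := by
    intro h
    have := Finsupp.nonTorsionWeight_of ℕ w hw
    exact hd0 ((Finsupp.weight_eq_zero_iff_eq_zero w).mp h)
  omega

theorem jacobianIdeal_eq_span_pair :
    jacobianIdeal V = Ideal.span {pderiv 0 V, pderiv 1 V} := by
  rw [jacobianIdeal]
  congr 1
  ext p
  simp [Fin.exists_fin_two, eq_comm]

attribute [local instance] MvPolynomial.weightedGradedAlgebra

/-- The complete intersection formula is applied to the variables themselves, whose quotient is `ℂ`
in degree `0`. -/
theorem dimSeries_top_mul (hw : ∀ i, w i ≠ 0) :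
    dimSeries (weightedHomogeneousSubmodule ℂ w) ⊤ *
      ((1 - PowerSeries.X ^ w 0) * (1 - PowerSeries.X ^ w 1)) = 1 := by
  have hfin (d : ℕ) : Module.Finite ℂ (weightedHomogeneousSubmodule ℂ w d) :=
    Module.Finite.iff_fg.mpr (weightedHomogeneousSubmodule_fg ℂ w hw d)
  have hweight (m : Fin 2 →₀ ℕ) : Finsupp.weight w m = 0 ↔ m = 0 :=
    have := Finsupp.nonTorsionWeight_of ℕ w hw
    Finsupp.weight_eq_zero_iff_eq_zero w
  have hspan : Ideal.span (X '' Set.univ) =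
      (Ideal.span {X 0, X 1} : Ideal (MvPolynomial (Fin 2) ℂ)) := by
    congr 1
    ext p
    simp [Fin.exists_fin_two, eq_comm]
  rw [mul_comm, ← dimSeries_top_sub_span_pair _ (isWeightedHomogeneous_X ℂ w 0)
    (isWeightedHomogeneous_X ℂ w 1) (X_ne_zero 0) (X_ne_zero 1) isRelPrime_X_zero_X_one]
  ext d
  rw [PowerSeries.coeff_one]
  split_ifs with hd
  · subst hd
    have h1 : weightedHomogeneousSubmodule ℂ w 0 ⊓
        (⊤ : Ideal (MvPolynomial (Fin 2) ℂ)).restrictScalars ℂ = Submodule.span ℂ {1} := by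
      ext p
      simp only [Submodule.mem_inf, Submodule.restrictScalars_mem, Submodule.mem_top, and_true,
        Submodule.mem_span_singleton]
      constructor
      · intro hp
        refine ⟨coeff 0 p, ?_⟩
        ext m
        by_cases hm : m = 0
        · simp [hm]
        · have : coeff m p = 0 := by
            by_contra h
            exact hm ((hweight m).mp (hp h))
          simp [this, coeff_one, Ne.symm hm]
      · rintro ⟨c, rfl⟩
        exact Submodule.smul_mem _ _ (isWeightedHomogeneous_one ℂ w)
    have h2 : weightedHomogeneousSubmodule ℂ w 0 ⊓
        (Ideal.span {X 0, X 1} : Ideal (MvPolynomial (Fin 2) ℂ)).restrictScalars ℂ = ⊥ := by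
      rw [eq_bot_iff]
      rintro p ⟨hp, hp'⟩
      rw [Submodule.mem_bot]
      ext m
      by_contra hm
      rw [coeff_zero] at hm
      rw [← hspan] at hp'
      obtain ⟨i, -, hi⟩ := mem_ideal_span_X_image.mp hp' m (mem_support_iff.mpr hm)
      rw [(hweight m).mp (hp hm)] at hi
      exact hi rfl
    simp only [map_sub, dimSeries, PowerSeries.coeff_mk]
    rw [h1, h2, finrank_span_singleton one_ne_zero]
    simp
  · rw [coeff_dimSeries_top_sub_eq_zero_iff]
    intro p hp
    rw [Submodule.restrictScalars_mem, ← hspan]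
    refine mem_ideal_span_X_image.mpr fun m hm => ?_
    by_contra! h
    have hm0 : m = 0 := by
      ext i
      exact h i (Set.mem_univ i)
    have := hp (mem_support_iff.mp hm)
    rw [hm0, map_zero] at this
    exact hd this.symm

/-- The top degree of the Milnor ring of a quasihomogeneous isolated singularity. -/
theorem top_degree (hV : IsNondegenerate V) (hw : ∀ i, w i ≠ 0)
    (hN : IsWeightedHomogeneous w V N) {T : ℕ}
    (hT : ¬ weightedHomogeneousSubmodule ℂ w T ≤ (jacobianIdeal V).restrictScalars ℂ)
    (hT' : ∀ d, T < d →
      weightedHomogeneousSubmodule ℂ w d ≤ (jacobianIdeal V).restrictScalars ℂ) :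
    T + 2 * (w 0 + w 1) = 2 * N := by
  have hfin (d : ℕ) : Module.Finite ℂ (weightedHomogeneousSubmodule ℂ w d) :=
    Module.Finite.iff_fg.mpr (weightedHomogeneousSubmodule_fg ℂ w hw d)
  have hrel := isRelPrime_pderiv hV hw hN
  have h0 := weight_lt hV hw hN 0
  have h1 := weight_lt hV hw hN 1
  -- The partials have degrees `N - w 0` and `N - w 1`, so comparing degrees gives `T + w 0 + w 1 =
  -- (N - w 0) + (N - w 1)`.
  have hser := dimSeries_top_sub_span_pair (weightedHomogeneousSubmodule ℂ w)
    (isWeightedHomogeneous_pderiv hN 0)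
    (isWeightedHomogeneous_pderiv hN 1) (pderiv_ne_zero hV hrel 0) (pderiv_ne_zero hV hrel 1) hrel
  rw [← jacobianIdeal_eq_span_pair] at hser
  have := degree_of_mul_eq (H := dimSeries (weightedHomogeneousSubmodule ℂ w) ⊤ -
      dimSeries (weightedHomogeneousSubmodule ℂ w) (jacobianIdeal V))
    (T := T) (a := N - w 0) (b := N - w 1) (by omega) (by omega) (hw 0) (hw 1)
    (by rwa [Ne, coeff_dimSeries_top_sub_eq_zero_iff])
    (fun d hd => (coeff_dimSeries_top_sub_eq_zero_iff _ _ d).mpr (hT' d hd))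
    (by rw [hser, mul_assoc, dimSeries_top_mul hw, mul_one])
  omega

/-- A variable that vanishes in the Milnor ring occurs linearly in a partial derivative. -/
theorem weight_add_of_X_mem (hV : IsNondegenerate V)
    (hN : IsWeightedHomogeneous w V N) {i : Fin 2} (hi : X i ∈ jacobianIdeal V) :
    ∃ j, w i + w j = N := by
  by_contra! hne
  have hz (j : Fin 2) : coeff (Finsupp.single i 1) (pderiv j V) = 0 := by
    by_contra h
    rw [coeff_pderiv] at h
    have := hN (left_ne_zero_of_mul h)
    simp [Finsupp.weight_single] at this
    exact hne j this
  -- The vanishing constant term must be carried along: the linear coefficient of `r * p` also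
  -- involves the constant term of `p`.
  have key (p : MvPolynomial (Fin 2) ℂ) (hp : p ∈ jacobianIdeal V) :
      coeff (Finsupp.single i 1) p = 0 ∧ constantCoeff p = 0 := by
    refine Submodule.span_induction ?_ ?_ ?_ ?_ hp
    · rintro _ ⟨j, rfl⟩
      exact ⟨hz j, by rw [← eval_zero']; exact hV.1 j⟩
    · simp
    · rintro p q - - ⟨h1, h2⟩ ⟨h3, h4⟩
      simp [h1, h2, h3, h4]
    · rintro r p - ⟨h1, h2⟩
      refine ⟨?_, by simp [h2]⟩
      rw [smul_eq_mul, coeff_mul, Finsupp.antidiagonal_single]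
      rw [constantCoeff_eq] at h2
      simp [Finset.Nat.antidiagonal_succ, h1, h2]
  have := (key _ hi).1
  simp at this

end LandauGinzburg

/-! ### Degrees of the A-model sectors -/

namespace LandauGinzburg

open MvPolynomial

theorem phase_eq {z : ℂˣ} {θ : ℝ} (h0 : 0 ≤ θ) (h1 : θ < 1)
    (hz : Complex.exp (2 * Real.pi * Complex.I * (θ : ℂ)) = z) : phase z = θ := by
  have hnorm : ‖(z : ℂ)‖ = 1 := by
    rw [← hz, show 2 * Real.pi * Complex.I * (θ : ℂ) =
      ((2 * Real.pi * θ : ℝ) : ℂ) * Complex.I by push_cast; ring, Complex.norm_exp_ofReal_mul_I]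
  have h := (exp_phase z hnorm).trans hz.symm
  rw [Complex.exp_eq_exp_iff_exists_int] at h
  obtain ⟨m, hm⟩ := h
  have hm' : (2 * Real.pi * Complex.I) * (phase z : ℂ) =
      (2 * Real.pi * Complex.I) * ((θ + m : ℝ) : ℂ) := by
    rw [hm]
    push_cast
    ring
  have h2 : phase z = θ + m :=
    Complex.ofReal_injective (mul_left_cancel₀ Complex.two_pi_I_ne_zero hm')
  rw [phase] at h2 ⊢
  have h3 := Int.fract_nonneg (Complex.arg (z : ℂ) / (2 * Real.pi))
  have h4 := Int.fract_lt_one (Complex.arg (z : ℂ) / (2 * Real.pi))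
  have h5 : m < 1 := by exact_mod_cast (by linarith : (m : ℝ) < 1)
  have h6 : -1 < m := by exact_mod_cast (by linarith : (-1 : ℝ) < m)
  have h7 : m = 0 := by omega
  simpa [h7] using h2

section Sectors

variable {n : ℕ} {g : Fin 2 → ℂˣ}

theorem sectorDegree_eq {q : Fin 2 → ℚ} {j : ℕ} (hj0 : j ≠ 0) (hj : j < n)
    (hq : ∀ i, q i = 1 / (n : ℚ))
    (hg : ∀ i, Complex.exp (2 * Real.pi * Complex.I * (j / n)) = g i) :
    IsEmpty (Fix g) ∧ sectorDegree q g = 4 * ((j : ℝ) - 1) / n := by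
  have hn : (0 : ℝ) < n := by exact_mod_cast (by omega : 0 < n)
  have hph (i : Fin 2) : phase (g i) = j / n := by
    refine phase_eq (by positivity) ?_ ?_
    · rw [div_lt_one hn]
      exact_mod_cast hj
    · rw [← hg i]
      push_cast
      rfl
  have hE : IsEmpty (Fix g) := by
    refine ⟨fun ⟨i, hi⟩ => ?_⟩
    have h1 : phase 1 = 0 := phase_eq le_rfl one_pos (by simp)
    have := hph i
    rw [hi, h1, eq_comm, div_eq_zero_iff] at this
    rcases this with h | h
    · exact hj0 (by exact_mod_cast h)
    · exact hn.ne' h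
  refine ⟨hE, ?_⟩
  rw [sectorDegree, Fintype.card_eq_zero, Fin.sum_univ_two, hph, hph, hq, hq]
  push_cast
  field_simp
  ring

/-- Every element of the group is a scalar `n`-th root of unity. The bound `3 < n` keeps the
identity sector, of degree `(2n - 4)/n`, out of the gap below `4/n`. -/
theorem sectorDegree_cases (hn : 3 < n)
    (hg : g ∈ Subgroup.zpowers (gradingElement fun _ : Fin 2 => 1 / (n : ℚ))) :
    let d := sectorDegree (fun _ => 1 / (n : ℚ)) g
    (d = 0 ∨ 4 / (n : ℝ) ≤ d) ∧ d ≤ (4 * n - 8) / n := by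
  intro d
  have hn0 : (0 : ℝ) < n := by exact_mod_cast (by omega : 0 < n)
  have hn4 : (4 : ℝ) ≤ n := by exact_mod_cast hn
  obtain ⟨k, rfl⟩ := hg
  set z : ℂˣ := gradingElement (fun _ : Fin 2 => 1 / (n : ℚ)) 0 ^ k with hz
  have hgz (i : Fin 2) : (gradingElement (fun _ : Fin 2 => 1 / (n : ℚ)) ^ k) i = z := rfl
  have hz1 : z ^ n = 1 := by
    have : gradingElement (fun _ : Fin 2 => 1 / (n : ℚ)) 0 ^ n = 1 := by
      ext
      have hnC : (n : ℂ) ≠ 0 := by exact_mod_cast hn0.ne'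
      simp only [gradingElement, Units.val_pow_eq_pow_val, Units.val_mk0, ← Complex.exp_nat_mul]
      push_cast
      rw [show (n : ℂ) * (2 * Real.pi * Complex.I * (1 / n)) = 2 * Real.pi * Complex.I by
        field_simp, Complex.exp_two_pi_mul_I]
    rw [hz, ← zpow_natCast, ← zpow_mul, mul_comm, zpow_mul, zpow_natCast, this, one_zpow]
  have : NeZero n := ⟨by omega⟩
  obtain ⟨j, hj, hjz⟩ := (Complex.mem_rootsOfUnity n z).mp hz1
  by_cases hj0 : j = 0
  · have hone : gradingElement (fun _ : Fin 2 => 1 / (n : ℚ)) ^ k = 1 := by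
      funext i
      rw [hgz, Pi.one_apply]
      ext
      rw [← hjz, hj0]
      simp
    have h1 : phase 1 = 0 := phase_eq le_rfl one_pos (by simp)
    have hd : d = (2 * n - 4) / n := by
      have hcard : Fintype.card (Fix (1 : Fin 2 → ℂˣ)) = 2 :=
        (Fintype.card_congr (Equiv.subtypeUnivEquiv fun _ => rfl)).trans (Fintype.card_fin 2)
      simp only [d, hone, sectorDegree, hcard]
      simp [h1]
      field_simp
      ring
    rw [hd]
    refine ⟨Or.inr ?_, ?_⟩
    · gcongr
      linarith
    · gcongr ?_ / _
      linarith
  · have hd : d = 4 * ((j : ℝ) - 1) / n :=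
      (sectorDegree_eq hj0 hj (fun _ => rfl) fun _ => hjz).2
    rw [hd]
    constructor
    · rcases eq_or_ne j 1 with rfl | hj1
      · left
        simp
      · right
        have : (2 : ℝ) ≤ j := by exact_mod_cast (by omega : 2 ≤ j)
        gcongr
        linarith
    · have : (j : ℝ) + 1 ≤ n := by exact_mod_cast hj
      gcongr ?_ / _
      linarith

end Sectors

/-! ### Vanishing of graded pieces -/

section Pieces

variable {σ : Type} [Fintype σ]

theorem aPiece_eq_bot {W : MvPolynomial σ ℂ} {q : σ → ℚ} {G : Subgroup (σ → ℂˣ)}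
    {hG : G ≤ maxSymmetryGroup W} {d : ℝ} (h : ∀ g ∈ G, sectorDegree q g ≠ d) :
    aPiece W q G hG d = ⊥ := by
  rw [eq_bot_iff]
  intro v hv
  exact DFinsupp.ext fun g => hv g (h g.1 g.2)

/-- With no fixed variable the Milnor ring is `ℂ`, and the determinant is an empty product, so `1`
is invariant. -/
theorem aPiece_ne_bot {W : MvPolynomial σ ℂ} {q : σ → ℚ} {G : Subgroup (σ → ℂˣ)}
    {hG : G ≤ maxSymmetryGroup W} {g : σ → ℂˣ} (hg : g ∈ G) [IsEmpty (Fix g)] :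
    aPiece W q G hG (sectorDegree q g) ≠ ⊥ := by
  classical
  have hbot : jacobianIdeal (restrict g W) = ⊥ := by
    rw [jacobianIdeal, Set.range_eq_empty, Ideal.span_empty]
  have hne : (1 : MilnorRing (restrict g W)) ≠ 0 := by
    intro h
    have h1 : (1 : MvPolynomial (Fix g) ℂ) ∈ jacobianIdeal (restrict g W) := by
      rw [← Ideal.Quotient.eq_zero_iff_mem, map_one, h]
    rw [hbot] at h1
    exact one_ne_zero h1
  have hinv : (1 : MilnorRing (restrict g W)) ∈
      invariants (restrict g W) (G.map (restrictHom g)) (map_restrictHom_le hG g) := by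
    intro ζ hζ
    simp [milnorAction]
  intro h
  let v : AModel W G hG := DirectSum.of (Sector W G hG) ⟨g, hg⟩ ⟨1, hinv⟩
  have hv : v ∈ aPiece W q G hG (sectorDegree q g) := by
    intro g' hg'
    refine DirectSum.of_eq_of_ne _ _ _ fun h => hg' ?_
    rw [h]
  rw [h, Submodule.mem_bot] at hv
  have h2 : v ⟨g, hg⟩ = 0 := by rw [hv]; rfl
  rw [DirectSum.of_eq_same] at h2
  exact hne (congrArg Subtype.val h2)

/-- Transfers the real grading by `2 * q i` to the integral grading by `w`, where Hilbert series are
available. -/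
theorem bPiece_eq_bot_iff {V : MvPolynomial σ ℂ} {q : σ → ℚ} {w : σ → ℕ} {N : ℕ} (hN : N ≠ 0)
    (hq : ∀ i, q i = w i / N) (k : ℕ) :
    bPiece V q (2 * k / N) = ⊥ ↔
      weightedHomogeneousSubmodule ℂ w k ≤ (jacobianIdeal V).restrictScalars ℂ := by
  have hN' : (N : ℝ) ≠ 0 := by exact_mod_cast hN
  have h : weightedHomogeneousSubmodule ℂ (fun i => 2 * (q i : ℝ)) (2 * k / N) =
      weightedHomogeneousSubmodule ℂ w k := by
    ext p
    refine forall_congr' fun d => forall_congr' fun _ => ?_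
    rw [Finsupp.weight_apply, Finsupp.weight_apply, Finsupp.sum_fintype _ _ (by simp),
      Finsupp.sum_fintype _ _ (by simp)]
    have h1 : ∑ i, d i • (2 * (q i : ℝ)) = 2 * ((∑ i, d i • w i : ℕ) : ℝ) / N := by
      push_cast
      rw [Finset.mul_sum, Finset.sum_div]
      refine Finset.sum_congr rfl fun i _ => ?_
      rw [hq]
      push_cast
      simp only [nsmul_eq_mul, smul_eq_mul]
      push_cast
      ring
    rw [h1, div_left_inj' hN', mul_right_inj' two_ne_zero, Nat.cast_inj]
  rw [bPiece, h, ← LinearMap.le_ker_iff_map]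
  rw [show LinearMap.ker (Ideal.Quotient.mkₐ ℂ (jacobianIdeal V)).toLinearMap =
      (jacobianIdeal V).restrictScalars ℂ from ?_]
  ext p
  simp [Ideal.Quotient.eq_zero_iff_mem]

theorem exists_common_denominator {q : Fin 2 → ℚ} (hq : ∀ i, 0 < q i) :
    ∃ (D : ℕ) (u : Fin 2 → ℕ), D ≠ 0 ∧ ∀ i, q i = u i / D := by
  have key (r : ℚ) (hr : 0 < r) : (r : ℚ) = (r.num.toNat : ℚ) / r.den := by
    have h1 : ((r.num.toNat : ℤ) : ℚ) = r.num := by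
      rw [Int.toNat_of_nonneg (Rat.num_pos.mpr hr).le]
    rw [← Int.cast_natCast, h1, Rat.num_div_den]
  refine ⟨(q 0).den * (q 1).den, ![(q 0).num.toNat * (q 1).den, (q 1).num.toNat * (q 0).den],
    mul_ne_zero (q 0).den_nz (q 1).den_nz, ?_⟩
  have h0 : ((q 0).den : ℚ) ≠ 0 := by exact_mod_cast (q 0).den_nz
  have h1 : ((q 1).den : ℚ) ≠ 0 := by exact_mod_cast (q 1).den_nz
  refine Fin.forall_fin_two.mpr ⟨?_, ?_⟩
  · conv_lhs => rw [key _ (hq 0)]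
    simp
    field_simp
  · conv_lhs => rw [key _ (hq 1)]
    simp
    field_simp

theorem isWeightedHomogeneous_of_isWeightSystem {V : MvPolynomial σ ℂ} {q : σ → ℚ} {w : σ → ℕ}
    {N : ℕ} (hN : N ≠ 0) (hq : ∀ i, q i = w i / N) (h : IsWeightSystem V q) :
    IsWeightedHomogeneous w V N := by
  intro d hd
  have h1 := h.homogeneous hd
  have hN' : (N : ℚ) ≠ 0 := by exact_mod_cast hN
  rw [Finsupp.weight_apply, Finsupp.sum_fintype _ _ (by simp)] at h1 ⊢
  have h2 : ((∑ i, d i • w i : ℕ) : ℚ) = N * ∑ i, d i • q i := by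
    push_cast
    rw [Finset.mul_sum]
    refine Finset.sum_congr rfl fun i _ => ?_
    rw [hq]
    simp only [nsmul_eq_mul, smul_eq_mul]
    push_cast
    field_simp
  rw [h1, mul_one] at h2
  exact_mod_cast h2

end Pieces

end LandauGinzburg

/-! ### Comparison of the two models -/

theorem mainTheorem1 (n : ℕ) (hn : 3 < n) (W : MvPolynomial (Fin 2) ℂ)
    (hW : LandauGinzburg.IsAdmissible W) (hW' : LandauGinzburg.IsNoninvertible W)
    (hJ : LandauGinzburg.IsWeightSystem W (fun _ => 1 / (n : ℚ))) :
    ¬ ∃ (V : MvPolynomial (Fin 2) ℂ) (q : Fin 2 → ℚ),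
      LandauGinzburg.IsAdmissible V ∧ LandauGinzburg.IsWeightSystem V q ∧
      LandauGinzburg.GradedIso
        (LandauGinzburg.aPiece W (fun _ => 1 / (n : ℚ))
          (Subgroup.zpowers (LandauGinzburg.gradingElement fun _ => 1 / (n : ℚ)))
          (LandauGinzburg.zpowers_gradingElement_le hJ))
        (LandauGinzburg.bPiece V q) := by
  open LandauGinzburg MvPolynomial in
  rintro ⟨V, q, ⟨hV, -⟩, hq, φ, hφ⟩
  obtain ⟨D, u, hD, hu⟩ := exists_common_denominator hq.pos
  have hN : n * D ≠ 0 := mul_ne_zero (by omega) hD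
  have hnR : (0 : ℝ) < n := by exact_mod_cast (by omega : 0 < n)
  have hDR : (0 : ℝ) < D := by exact_mod_cast (by omega : 0 < D)
  have hnQ : (n : ℚ) ≠ 0 := by exact_mod_cast hnR.ne'
  -- The extra factor `n` in the denominator gives A-model degrees, multiples of `2/n`, the form `2
  -- * k / (n * D)` with `k` natural.
  have hqw (i : Fin 2) : q i = ((n * u i : ℕ) : ℚ) / ((n * D : ℕ) : ℚ) := by
    rw [hu]
    push_cast
    rw [mul_div_mul_left _ _ hnQ]
  have hu0 (i : Fin 2) : u i ≠ 0 := by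
    intro h
    have := hq.pos i
    rw [hu, h] at this
    simp at this
  have hw (i : Fin 2) : n * u i ≠ 0 := mul_ne_zero (by omega) (hu0 i)
  have hom := isWeightedHomogeneous_of_isWeightSystem hN hqw hq
  have hbot (k : ℕ) : aPiece W (fun _ => 1 / (n : ℚ))
      (Subgroup.zpowers (gradingElement fun _ => 1 / (n : ℚ))) (zpowers_gradingElement_le hJ)
      (2 * k / (n * D : ℕ)) = ⊥ ↔ weightedHomogeneousSubmodule ℂ (fun i => n * u i) k ≤
        (jacobianIdeal V).restrictScalars ℂ := by
    rw [← bPiece_eq_bot_iff hN hqw, ← hφ, ← LinearMap.le_ker_iff_map, LinearEquiv.ker, le_bot_iff]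
  -- Here `T = 2 * n * D - 4 * D` solves `2 * T / (n * D) = (4 * n - 8) / n`, the top A-model
  -- degree, attained by `J ^ (n - 1)`.
  have htop : n * D * 2 - 4 * D + 2 * (n * u 0 + n * u 1) = 2 * (n * D) := by
    have hcast : ((n * D * 2 - 4 * D : ℕ) : ℝ) = (2 * n - 4) * D := by
      rw [Nat.cast_sub (by nlinarith)]
      push_cast
      ring
    refine top_degree hV hw hom ?_ fun d hd => ?_
    · rw [← hbot, hcast]
      have hg : (gradingElement fun _ : Fin 2 => 1 / (n : ℚ)) ^ (n - 1) ∈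
          Subgroup.zpowers (gradingElement fun _ : Fin 2 => 1 / (n : ℚ)) :=
        Subgroup.npow_mem_zpowers _ _
      obtain ⟨hE, hdeg⟩ := sectorDegree_eq (n := n) (j := n - 1)
        (g := (gradingElement fun _ : Fin 2 => 1 / (n : ℚ)) ^ (n - 1))
        (q := fun _ => 1 / (n : ℚ)) (by omega) (by omega) (fun _ => rfl) (fun i => by
          simp only [gradingElement, Pi.pow_apply, Units.val_pow_eq_pow_val, Units.val_mk0,
            ← Complex.exp_nat_mul]
          congr 1
          push_cast
          ring)
      have := aPiece_ne_bot (W := W) (q := fun _ => 1 / (n : ℚ))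
        (hG := zpowers_gradingElement_le hJ) hg
      rw [hdeg] at this
      convert this using 2
      rw [Nat.cast_sub (by omega)]
      push_cast
      field_simp
      ring_nf
    · rw [← hbot]
      refine aPiece_eq_bot fun g hg h => ?_
      have h1 := (sectorDegree_cases hn hg).2
      rw [h, div_le_div_iff₀ (by exact_mod_cast (by omega : 0 < n * D)) hnR] at h1
      push_cast at h1
      have h2 : (2 * n - 4) * (D : ℝ) < d := by
        rw [← hcast]
        exact_mod_cast hd
      nlinarith
  have hsum : n * (u 0 + u 1) = 2 * D := by
    have : 4 * D ≤ n * D * 2 := by nlinarith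
    rw [mul_add]
    omega
  -- The sum relation says `q 0 + q 1 = 2/n`, so the smaller weight is at most `1/n`.
  obtain ⟨i, hi⟩ : ∃ i, n * u i ≤ D := by
    by_contra! h
    have h0 := h 0
    have h1 := h 1
    rw [mul_add] at hsum
    omega
  have hX : X i ∈ jacobianIdeal V := by
    refine (hbot (n * u i)).mp (aPiece_eq_bot fun g hg h => ?_)
      (isWeightedHomogeneous_X ℂ (fun i => n * u i) i)
    have hui : (0 : ℝ) < u i := by exact_mod_cast Nat.pos_of_ne_zero (hu0 i)
    rcases (sectorDegree_cases hn hg).1 with h1 | h1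
    · rw [h] at h1
      push_cast at h1
      have : 0 < 2 * ((n : ℝ) * u i) / (n * D) := by positivity
      linarith
    · rw [h, div_le_div_iff₀ hnR (by exact_mod_cast (by omega : 0 < n * D))] at h1
      push_cast at h1
      have h2 : (n : ℝ) * u i ≤ D := by exact_mod_cast hi
      nlinarith [mul_pos hnR hDR]
  obtain ⟨j, hj⟩ := weight_add_of_X_mem hV hom hX
  have hle : n * u j ≤ 2 * D := by
    rw [← hsum]
    refine Nat.mul_le_mul_left n ?_
    fin_cases j
    exacts [Nat.le_add_right _ _, Nat.le_add_left _ _]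
  -- Adding the two bounds gives `n * D ≤ 3 * D`, against `3 < n`.
  nlinarith [Nat.pos_of_ne_zero hD]
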